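/- Let $G$ be a finite simple bipartite graph whose vertex set is the disjoint union of two color classes, each with exactly $n \ge 1$ vertices (every edge joins the two classes), and suppose that $G$ is $r$-regular, i.e. every vertex has degree $r$. For a nonnegative integer $s$, let $W(G,s)$ denote the set of all matchings of size $s$ in $G$, that is, sets of $s$ pairwise vertex-disjoint edges of $G$. Then $$\#W(G,s) \;\ge\; \binom{n}{s}^2\, s!\, \left(\frac{r}{n}\right)^s .$$ -/

import Mathlib

open scoped Nat

/-- A matching of `G` of size `s`: a set of `s` pairwise vertex-disjoint edges of `G`.
`matchingsOfSize G s` is the set `W(G, s)` of all of them. -/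
def matchingsOfSize {V : Type*} (G : SimpleGraph V) (s : ℕ) : Set (Finset (Sym2 V)) :=
  {M | (∀ e ∈ M, e ∈ G.edgeSet) ∧
    (∀ e ∈ M, ∀ f ∈ M, e ≠ f → ∀ v : V, v ∈ e → v ∉ f) ∧
    M.card = s}

/-! The biadjacency matrix of `G` divided by `r` is a doubly stochastic matrix `A`. Sum `∏ i ∈ S, A
i (σ i)` over all `s`-sets `S` of rows and all permutations `σ`: the result is `r⁻ˢ` times the
number of pairs `(S, σ)` all of whose edges lie in `G`, and each matching arises from at most `(n -
s)!` such pairs. Hence Tverberg's bound for that sum, `le_sum_sum_prod_of_mem_doublyStochastic`,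
suffices.

Tverberg's bound follows by Gurvits' capacity method. The sum is the coefficient of `x₁⋯xₙ` in
`rowEsymm A s`. On the positive orthant, arithmetic-geometric means and double stochasticity bound
this polynomial below by a constant times `x₁⋯xₙ` (`capacity_rowEsymm_ge`). If `A` has positive
entries, it is moreover homogeneous and strongly stable, so at most a factor `n!/nⁿ` is lost in
passing from that constant to the coefficient (`mul_factorial_div_le_norm_coeff`). There the
variables are removed one at a time: stability forces the slices to have negative real roots, and
the univariate inequality costs `(m/(m+1))^m` per step. A limit admits zero entries. -/

/-- The inequality of arithmetic and geometric means, without roots. -/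
theorem prod_le_mean_pow_card {ι : Type*} (s : Finset ι) (y : ι → ℝ) (hy : ∀ i ∈ s, 0 ≤ y i) :
    ∏ i ∈ s, y i ≤ ((∑ i ∈ s, y i) / s.card) ^ s.card := by
  rcases s.eq_empty_or_nonempty with rfl | hs
  · simp
  have hc : (0 : ℝ) < s.card := by exact_mod_cast hs.card_pos
  have h := Real.geom_mean_le_arith_mean_weighted s (fun _ => (s.card : ℝ)⁻¹) y
    (fun _ _ => by positivity) (by simp [hc.ne']) hy
  have h2 := pow_le_pow_left₀ (Finset.prod_nonneg fun i hi => Real.rpow_nonneg (hy i hi) _) h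
    s.card
  rw [← Finset.prod_pow] at h2
  calc ∏ i ∈ s, y i = ∏ i ∈ s, (y i ^ (s.card : ℝ)⁻¹) ^ s.card := by
        refine Finset.prod_congr rfl fun i hi => ?_
        rw [Real.rpow_inv_natCast_pow (hy i hi) hs.card_ne_zero]
    _ ≤ _ := h2
    _ = _ := by rw [← Finset.mul_sum, inv_mul_eq_div]

/-! ### Univariate polynomials with roots in the open left half-plane. -/

namespace Polynomial

theorem coeff_zero_prod_one_add_C_mul_X {R ι : Type*} [CommRing R] (s : Finset ι) (b : ι → R) :
    (∏ i ∈ s, (1 + C (b i) * X)).coeff 0 = 1 := by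
  simp [coeff_zero_eq_eval_zero, eval_prod]

theorem coeff_one_prod_one_add_C_mul_X {R ι : Type*} [CommRing R] (s : Finset ι) (b : ι → R) :
    (∏ i ∈ s, (1 + C (b i) * X)).coeff 1 = ∑ i ∈ s, b i := by
  classical
  induction s using Finset.induction_on with
  | empty => simp [coeff_one]
  | insert a s ha ih =>
    rw [Finset.prod_insert ha, mul_coeff_one, coeff_zero_prod_one_add_C_mul_X, ih,
      Finset.sum_insert ha]
    simp [coeff_one, coeff_X, add_comm]

theorem exists_eq_prod_of_forall_root_neg {f : ℂ[X]} {m : ℕ} (hdeg : f.natDegree = m)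
    (hroots : ∀ z, f.eval z = 0 → ∃ b : ℝ, 0 < b ∧ z = -b) :
    ∃ (c : ℂ) (b : Fin m → ℝ), (∀ i, 0 < b i) ∧ f = C c * ∏ i, (1 + C (b i : ℂ) * X) := by
  by_cases hf : f = 0
  · exact ⟨0, fun _ => 1, fun _ => one_pos, by simp [hf]⟩
  have hs := IsAlgClosed.splits f
  obtain ⟨l, hl⟩ := Quot.exists_rep f.roots
  replace hl : (l : Multiset ℂ) = f.roots := hl
  have hlen : l.length = m := by
    rw [← hdeg, hs.natDegree_eq_card_roots, ← hl, Multiset.coe_card]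
  subst hlen
  have hr : ∀ i : Fin l.length, ∃ b : ℝ, 0 < b ∧ l.get i = -b := fun i => by
    refine hroots _ ?_
    have : l.get i ∈ f.roots := by rw [← hl]; simp
    exact (mem_roots'.1 this).2
  choose b hb hlb using hr
  refine ⟨f.leadingCoeff * ∏ i, (b i : ℂ), fun i => (b i)⁻¹, fun i => inv_pos.2 (hb i), ?_⟩
  have hprod : f = C f.leadingCoeff * ∏ i, (X - C (l.get i)) := by
    conv_lhs => rw [hs.eq_prod_roots, ← hl]
    congr 1
    rw [Multiset.map_coe, Multiset.prod_coe, ← List.prod_ofFn]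
    congr 1
    conv_lhs => rw [← List.ofFn_get l, List.map_ofFn]
    rfl
  conv_lhs => rw [hprod]
  rw [C_mul, mul_assoc, map_prod, ← Finset.prod_mul_distrib]
  congr 1
  refine Finset.prod_congr rfl fun i _ => ?_
  have : (b i : ℂ) ≠ 0 := by exact_mod_cast (hb i).ne'
  rw [mul_add, ← mul_assoc, ← C_mul, hlb]
  simp [this, add_comm]

/-- Gurvits' univariate inequality: the slope at zero of a polynomial with negative real roots is
controlled from below by the infimum of `f t / t`. -/
theorem mul_le_norm_coeff_one {f : ℂ[X]} {m : ℕ} (hm : m ≠ 0) (hdeg : f.natDegree = m + 1)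
    (hroots : ∀ z, f.eval z = 0 → ∃ b : ℝ, 0 < b ∧ z = -b) {K : ℝ}
    (hK : ∀ t : ℝ, 0 < t → K * t ≤ ‖f.eval (t : ℂ)‖) :
    K * ((m : ℝ) / (m + 1)) ^ m ≤ ‖f.coeff 1‖ := by
  obtain ⟨c, b, hb, rfl⟩ := exists_eq_prod_of_forall_root_neg hdeg hroots
  have hm' : (0 : ℝ) < m := by positivity
  set B := ∑ i, b i with hB
  have hBpos : 0 < B := Finset.sum_pos (fun i _ => hb i) Finset.univ_nonempty
  have hco : ‖(C c * ∏ i, (1 + C (b i : ℂ) * X)).coeff 1‖ = ‖c‖ * B := by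
    rw [coeff_C_mul, coeff_one_prod_one_add_C_mul_X, norm_mul, ← Complex.ofReal_sum,
      Complex.norm_of_nonneg hBpos.le]
  rw [hco]
  -- This is the minimizer over `t > 0` of `(1 + B t / (m + 1)) ^ (m + 1) / t`, the mean bound for
  -- `f t / t` up to the factor `‖c‖`.
  have ht : 0 < (m + 1 : ℝ) / (m * B) := by positivity
  have h1 := hK _ ht
  set t := (m + 1 : ℝ) / (m * B) with htdef
  have hev : ‖(C c * ∏ i, (1 + C (b i : ℂ) * X)).eval (t : ℂ)‖ = ‖c‖ * ∏ i, (1 + b i * t) := by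
    rw [eval_mul, eval_C, norm_mul, eval_prod]
    congr 1
    have : ∏ i, (1 + C (b i : ℂ) * X).eval (t : ℂ) = ((∏ i, (1 + b i * t) : ℝ) : ℂ) := by
      push_cast
      simp
    rw [this, Complex.norm_of_nonneg]
    exact Finset.prod_nonneg fun i _ => by have := hb i; positivity
  rw [hev] at h1
  have h2 := prod_le_mean_pow_card Finset.univ (fun i => 1 + b i * t)
    (fun i _ => by have := hb i; positivity)
  have h3 : (∑ i, (1 + b i * t)) / (Finset.univ : Finset (Fin (m + 1))).card
      = (m + 1 : ℝ) / m := by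
    rw [Finset.sum_add_distrib, ← Finset.sum_mul, ← hB, htdef]
    simp
    field_simp
  rw [h3, Finset.card_fin] at h2
  have h4 : K * t ≤ ‖c‖ * ((m + 1 : ℝ) / m) ^ (m + 1) :=
    h1.trans (mul_le_mul_of_nonneg_left h2 (norm_nonneg _))
  have h5 : K ≤ ‖c‖ * B * ((m + 1 : ℝ) / m) ^ m := by
    have : K = K * t * (m * B / (m + 1)) := by rw [htdef]; field_simp
    rw [this]
    calc _ ≤ ‖c‖ * ((m + 1 : ℝ) / m) ^ (m + 1) * (m * B / (m + 1)) :=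
          mul_le_mul_of_nonneg_right h4 (by positivity)
      _ = _ := by rw [pow_succ]; field_simp
  calc K * ((m : ℝ) / (m + 1)) ^ m
      ≤ ‖c‖ * B * ((m + 1 : ℝ) / m) ^ m * ((m : ℝ) / (m + 1)) ^ m :=
        mul_le_mul_of_nonneg_right h5 (by positivity)
    _ = ‖c‖ * B := by
        rw [mul_assoc, ← mul_pow]
        have : ((m + 1 : ℝ) / m) * ((m : ℝ) / (m + 1)) = 1 := by field_simp
        rw [this, one_pow, mul_one]

/-- Coefficients of a Hurwitz stable polynomial do not vanish. -/
theorem coeff_ne_zero_of_forall_root_re_neg {f : ℂ[X]} (hf : f ≠ 0)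
    (hroots : ∀ z, f.eval z = 0 → z.re < 0) {k : ℕ} (hk : k ≤ f.natDegree) : f.coeff k ≠ 0 := by
  induction k generalizing f with
  | zero =>
    intro h
    rw [coeff_zero_eq_eval_zero] at h
    simpa using hroots 0 h
  | succ k ih =>
    have hnat : f.derivative.natDegree = f.natDegree - 1 := natDegree_derivative f
    have hpos : 0 < f.degree := natDegree_pos_iff_degree_pos.1 (by omega)
    have hd : f.derivative ≠ 0 := fun h => by
      have := derivative_eq_zero.1 h
      omega
    have key : f.derivative.coeff k ≠ 0 := by
      refine ih hd (fun z hz => ?_) (by omega)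
      have hz' : z ∈ f.derivative.rootSet ℂ := by
        rw [mem_rootSet]; exact ⟨hd, by simpa using hz⟩
      -- Gauss–Lucas: the open left half-plane is convex, so differentiation keeps the roots in it.
      have h1 := rootSet_derivative_subset_convexHull_rootSet hpos hz'
      have hconv : Convex ℝ {w : ℂ | w.re < 0} := convex_halfSpace_re_lt 0
      refine convexHull_min (fun w hw => ?_) hconv h1
      rw [mem_rootSet] at hw
      exact hroots w (by simpa using hw.2)
    intro h
    rw [coeff_derivative, h, zero_mul] at key
    exact key rfl

end Polynomial

/-! ### Strongly stable homogeneous polynomials and the capacity bound. -/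

namespace MvPolynomial

theorem IsHomogeneous.eval_smul' {σ R : Type*} [CommSemiring R] {q : MvPolynomial σ R} {d : ℕ}
    (hq : q.IsHomogeneous d) (c : R) (z : σ → R) :
    eval (fun j => c * z j) q = c ^ d * eval z q := by
  rw [eval_eq, eval_eq, Finset.mul_sum]
  refine Finset.sum_congr rfl fun m hm => ?_
  have hdeg : ∑ i ∈ m.support, m i = d := by
    have h := hq (mem_support_iff.1 hm)
    simpa [Finsupp.weight_apply, Finsupp.sum] using h
  simp_rw [mul_pow]
  rw [Finset.prod_mul_distrib, Finset.prod_pow_eq_pow_sum, hdeg]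
  ring

/-- Nonvanishing on the closed right half-space with the imaginary subspace removed. -/
def IsStronglyStable {σ : Type*} (q : MvPolynomial σ ℂ) : Prop :=
  ∀ z : σ → ℂ, (∀ j, 0 ≤ (z j).re) → (∃ j, 0 < (z j).re) → eval z q ≠ 0

variable {m d : ℕ} {q : MvPolynomial (Fin (m + 1)) ℂ}

/-- The polynomial in the first variable obtained by fixing the others. -/
noncomputable def sliceZero (q : MvPolynomial (Fin (m + 1)) ℂ) (z : Fin m → ℂ) :
    Polynomial ℂ :=
  Polynomial.map (eval z) (finSuccEquiv ℂ m q)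

theorem eval_sliceZero (q : MvPolynomial (Fin (m + 1)) ℂ) (z : Fin m → ℂ) (t : ℂ) :
    (sliceZero q z).eval t = eval (Fin.cons t z : Fin (m + 1) → ℂ) q :=
  (eval_eq_eval_mv_eval' z t q).symm

theorem coeff_sliceZero (q : MvPolynomial (Fin (m + 1)) ℂ) (z : Fin m → ℂ) (k : ℕ) :
    (sliceZero q z).coeff k = eval z ((finSuccEquiv ℂ m q).coeff k) := by
  simp [sliceZero, Polynomial.coeff_map]

theorem IsHomogeneous.natDegree_sliceZero_le (hq : q.IsHomogeneous d) (z : Fin m → ℂ) :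
    (sliceZero q z).natDegree ≤ d := by
  by_cases h : q = 0
  · simp [h, sliceZero]
  refine Polynomial.natDegree_map_le.trans ?_
  rw [natDegree_finSuccEquiv]
  exact (degreeOf_le_totalDegree q 0).trans (hq.totalDegree h).le

theorem IsHomogeneous.coeff_sliceZero_self (hq : q.IsHomogeneous d) (z : Fin m → ℂ) :
    (sliceZero q z).coeff d = eval (Fin.cons 1 0 : Fin (m + 1) → ℂ) q := by
  have h0 : ∀ w : Fin m → ℂ, (sliceZero q w).coeff d = coeff 0 ((finSuccEquiv ℂ m q).coeff d) := by
    intro w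
    rw [coeff_sliceZero]
    -- The top coefficient is homogeneous of degree zero in the other variables, so it may be
    -- computed at the origin, where the lower ones vanish.
    have h := hq.finSuccEquiv_coeff_isHomogeneous d 0 (add_zero d)
    rw [totalDegree_eq_zero_iff_eq_C.1 (Nat.le_zero.1 h.totalDegree_le)]
    simp
  rw [h0 z, ← h0 0, ← eval_sliceZero, Polynomial.eval_eq_sum_range'
    (Nat.lt_succ_of_le (hq.natDegree_sliceZero_le 0)), Finset.sum_range_succ]
  rw [Finset.sum_eq_zero, zero_add, one_pow, mul_one]
  intro i hi
  rw [Finset.mem_range] at hi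
  have h := hq.finSuccEquiv_coeff_isHomogeneous i (d - i) (by omega)
  have h2 := h.eval_smul' 0 0
  simp only [Pi.zero_apply, mul_zero] at h2
  rw [coeff_sliceZero, one_pow, mul_one]
  change eval (fun _ => 0) _ = 0
  rw [h2, zero_pow (by omega), zero_mul]

/-- The leading coefficient is the value of `q` at `(1, 0, …, 0)`. That point lies on the boundary
of the open half-space region, which is why strong stability asks for only one coordinate with
positive real part. -/
theorem IsStronglyStable.natDegree_sliceZero (hs : IsStronglyStable q) (hq : q.IsHomogeneous d)
    (z : Fin m → ℂ) : (sliceZero q z).natDegree = d := by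
  refine le_antisymm (hq.natDegree_sliceZero_le z) (Polynomial.le_natDegree_of_ne_zero ?_)
  rw [hq.coeff_sliceZero_self]
  refine hs _ (fun j => ?_) ⟨0, by simp⟩
  refine Fin.cases ?_ (fun i => ?_) j <;> simp

/-- For `z` in the stability region, a root of the slice with nonnegative real part would give a
zero of `q` in its own region. The slice is thus Hurwitz stable, and none of its coefficients up to
its degree vanishes. -/
theorem IsStronglyStable.coeff_one (hs : IsStronglyStable q) (hq : q.IsHomogeneous d)
    (hd : d ≠ 0) : IsStronglyStable ((finSuccEquiv ℂ m q).coeff 1) := by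
  intro z hz hz'
  have hdeg := hs.natDegree_sliceZero hq z
  rw [← coeff_sliceZero]
  refine Polynomial.coeff_ne_zero_of_forall_root_re_neg
    (fun h => hd (by rw [← hdeg, h, Polynomial.natDegree_zero])) (fun t ht => ?_)
    (by rw [hdeg]; omega)
  by_contra! hre
  rw [eval_sliceZero] at ht
  refine hs _ (fun j => ?_) ?_ ht
  · exact Fin.cases (by simpa using hre) (fun i => by simpa using hz i) j
  · obtain ⟨j, hj⟩ := hz'
    exact ⟨j.succ, by simpa using hj⟩

theorem IsStronglyStable.exists_root_eq_neg (hs : IsStronglyStable q) (hq : q.IsHomogeneous d)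
    (hm : m ≠ 0) {x : Fin m → ℝ} (hx : ∀ j, 0 < x j) {t : ℂ}
    (ht : (sliceZero q (fun j => (x j : ℂ))).eval t = 0) : ∃ b : ℝ, 0 < b ∧ t = -b := by
  rw [eval_sliceZero] at ht
  have j₀ : Fin m := ⟨0, by omega⟩
  have ht0 : t ≠ 0 := by
    rintro rfl
    refine hs _ (fun j => ?_) ⟨j₀.succ, by simpa using hx j₀⟩ ht
    exact Fin.cases (by simp) (fun i => by simpa using (hx i).le) j
  have habs : 0 < ‖t‖ := norm_pos_iff.2 ht0
  by_cases hre : 0 < ‖t‖ + t.re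
  · exfalso
    -- By homogeneity the zero can be rotated. Multiplication by `‖t‖ + conj t` sends `t` to `‖t‖ (t
    -- + ‖t‖)`, and both this and the multiples of the `x j` have positive real part unless `t` is a
    -- negative real.
    have hrot := hq.eval_smul' ((‖t‖ : ℂ) + (starRingEnd ℂ) t)
      (Fin.cons t (fun j => (x j : ℂ)) : Fin (m + 1) → ℂ)
    rw [ht, mul_zero] at hrot
    refine hs _ (fun j => ?_) ⟨j₀.succ, ?_⟩ hrot
    · refine Fin.cases ?_ (fun i => ?_) j
      · have hsq : t.re * t.re + t.im * t.im = ‖t‖ * ‖t‖ := by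
          rw [Complex.norm_mul_self_eq_normSq, Complex.normSq_apply]
        simp only [Fin.cons_zero, Complex.mul_re, Complex.add_re, Complex.ofReal_re,
          Complex.conj_re, Complex.add_im, Complex.ofReal_im, Complex.conj_im, zero_add]
        nlinarith [mul_pos habs hre]
      · have := mul_pos hre (hx i)
        simpa using this.le
    · have := mul_pos hre (hx j₀)
      simpa using this
  · refine ⟨‖t‖, habs, ?_⟩
    have hle : t.re = -‖t‖ := by
      have := neg_le_of_abs_le (Complex.abs_re_le_norm t)
      linarith
    have him : t.im = 0 := by
      have hsq : t.re * t.re + t.im * t.im = ‖t‖ * ‖t‖ := by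
        rw [Complex.norm_mul_self_eq_normSq, Complex.normSq_apply]
      rw [hle] at hsq
      nlinarith
    apply Complex.ext <;> simp [hle, him]

/-- Gurvits' inequality: the coefficient of the product of all the variables is bounded from below
in terms of the capacity. -/
theorem IsStronglyStable.mul_factorial_div_le_norm_coeff {m : ℕ} {q : MvPolynomial (Fin m) ℂ}
    (hs : IsStronglyStable q) (hq : q.IsHomogeneous m) {K : ℝ}
    (hK : ∀ x : Fin m → ℝ, (∀ j, 0 < x j) → K * ∏ j, x j ≤ ‖eval (fun j => (x j : ℂ)) q‖) :
    K * (m ! / (m : ℝ) ^ m) ≤ ‖coeff (Finsupp.equivFunOnFinite.symm fun _ => 1) q‖ := by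
  induction m generalizing K with
  | zero =>
    have h := hK (fun _ => 1) (fun _ => one_pos)
    rw [eq_C_of_isEmpty q] at h ⊢
    have he : (Finsupp.equivFunOnFinite.symm fun _ => 1 : Fin 0 →₀ ℕ) = 0 := Subsingleton.elim _ _
    rw [he]
    simpa using h
  | succ m ih =>
    have hcons : (Finsupp.equivFunOnFinite.symm fun _ => 1 : Fin (m + 1) →₀ ℕ)
        = Finsupp.cons 1 (Finsupp.equivFunOnFinite.symm fun _ => 1) := by
      ext j
      exact Fin.cases (by simp) (fun i => by simp) j
    rw [hcons, ← finSuccEquiv_coeff_coeff]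
    have hs' := hs.coeff_one hq m.succ_ne_zero
    have hq' := hq.finSuccEquiv_coeff_isHomogeneous 1 m (add_comm 1 m)
    have key : ∀ x : Fin m → ℝ, (∀ j, 0 < x j) →
        K * ((m : ℝ) / (m + 1)) ^ m * ∏ j, x j ≤
          ‖eval (fun j => (x j : ℂ)) ((finSuccEquiv ℂ m q).coeff 1)‖ := by
      intro x hx
      have hslice : ∀ t : ℝ, 0 < t →
          K * (∏ j, x j) * t ≤ ‖(sliceZero q (fun j => (x j : ℂ))).eval (t : ℂ)‖ := by
        intro t ht
        have h := hK (Fin.cons t x) (fun j => Fin.cases (by simpa using ht)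
          (fun i => by simpa using hx i) j)
        rw [Fin.prod_univ_succ] at h
        simp only [Fin.cons_zero, Fin.cons_succ] at h
        rw [eval_sliceZero]
        have hc : (fun j => ((Fin.cons t x : Fin (m + 1) → ℝ) j : ℂ))
            = (Fin.cons (t : ℂ) (fun j => (x j : ℂ)) : Fin (m + 1) → ℂ) := by
          funext j
          exact Fin.cases (by simp) (fun i => by simp) j
        rw [hc] at h
        linarith
      rw [← coeff_sliceZero]
      -- With a single variable `q` is linear without constant term, so the bound at `t = 1` is
      -- already the claim; the univariate inequality needs `m ≠ 0`.
      rcases eq_or_ne m 0 with rfl | hm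
      · have h1 := hslice 1 one_pos
        have h0 := hq.finSuccEquiv_coeff_isHomogeneous 0 1 (zero_add 1)
        have h00 := h0.eval_smul' 0 (fun j => (x j : ℂ))
        rw [Polynomial.eval_eq_sum_range' (Nat.lt_succ_of_le (hq.natDegree_sliceZero_le _)),
          Finset.sum_range_succ, Finset.sum_range_one, coeff_sliceZero q _ 0,
          Subsingleton.elim (fun j => (x j : ℂ)) (fun j => 0 * (x j : ℂ)), h00] at h1
        rw [Subsingleton.elim (fun j => (x j : ℂ)) (fun j => 0 * (x j : ℂ))]
        simpa using h1
      · have h := Polynomial.mul_le_norm_coeff_one hm (hs.natDegree_sliceZero hq _)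
          (fun z hz => hs.exists_root_eq_neg hq hm hx hz) hslice
        linarith
    have h := ih hs' hq' key
    refine le_trans (le_of_eq ?_) h
    rcases eq_or_ne m 0 with rfl | hm
    · simp
    have hm' : (m : ℝ) ≠ 0 := by exact_mod_cast hm
    have hm1 : (m + 1 : ℝ) ≠ 0 := by positivity
    rw [Nat.factorial_succ]
    push_cast
    rw [div_pow, pow_succ]
    field_simp

end MvPolynomial

/-! ### Mean inequalities behind the capacity estimate. -/

open Finset in
theorem card_filter_mem_powersetCard {n : ℕ} (k : ℕ) (i : Fin n) :
    #{S ∈ powersetCard k (univ : Finset (Fin n)) | i ∈ S} = n.choose k - (n - 1).choose k := by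
  have h := card_filter_add_card_filter_not (s := powersetCard k (univ : Finset (Fin n)))
    (fun S => i ∈ S)
  have h2 : {S ∈ powersetCard k (univ : Finset (Fin n)) | i ∉ S}
      = powersetCard k (univ.erase i) := by
    ext S
    simp only [mem_filter, mem_powersetCard, subset_univ, true_and, subset_erase]
    tauto
  rw [h2, card_powersetCard, card_powersetCard, card_erase_of_mem (mem_univ i), card_fin] at h
  omega

open Finset in
/-- The geometric mean of the `k`-fold products, compared with their arithmetic mean. -/
theorem choose_mul_pow_mul_le_esymm_mul_pow {n k : ℕ} (hn : n ≠ 0) (hk : k ≤ n) {y : Fin n → ℝ}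
    (hy : ∀ i, 0 < y i) {P s : ℝ} (hP : 0 < P) (hs : 0 ≤ s) (hPy : P ≤ ∏ i, y i)
    (hPs : P ≤ (s / n) ^ n) :
    n.choose k * (n : ℝ) ^ (n - k) * P ≤
      (∑ S ∈ powersetCard k (univ : Finset (Fin n)), ∏ i ∈ S, y i) * s ^ (n - k) := by
  set N := n.choose k with hN
  -- The number of `k`-sets containing a given index; the subtractive form is also correct for `k =
  -- 0`.
  set c := N - (n - 1).choose k with hc
  set e := ∑ S ∈ powersetCard k (univ : Finset (Fin n)), ∏ i ∈ S, y i with he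
  have hNpos : 0 < N := Nat.choose_pos hk
  have hn' : (0 : ℝ) < n := by positivity
  have hN' : (0 : ℝ) < N := by exact_mod_cast hNpos
  have hcN : c ≤ N := Nat.sub_le _ _
  have hcount : N * k = n * c := by
    have h1 : ∑ S ∈ powersetCard k (univ : Finset (Fin n)), #S = N * k := by
      rw [sum_const_nat (m := k) fun S hS => (mem_powersetCard.1 hS).2, card_powersetCard,
        card_fin]
    have h2 : ∑ S ∈ powersetCard k (univ : Finset (Fin n)), ∑ _i ∈ S, 1
        = ∑ i : Fin n, ∑ _S ∈ powersetCard k (univ : Finset (Fin n)) with i ∈ _S, 1 :=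
      sum_comm' (by simp)
    simp only [sum_const, smul_eq_mul, mul_one, card_filter_mem_powersetCard] at h2
    rw [← h1, h2]
    simp [hc, hN]
  have hprod : ∏ S ∈ powersetCard k (univ : Finset (Fin n)), ∏ i ∈ S, y i = (∏ i, y i) ^ c := by
    have h2 : ∏ S ∈ powersetCard k (univ : Finset (Fin n)), ∏ i ∈ S, y i
        = ∏ i : Fin n, ∏ _S ∈ powersetCard k (univ : Finset (Fin n)) with i ∈ _S, y i :=
      prod_comm' (by simp)
    rw [h2, ← prod_pow]
    refine prod_congr rfl fun i _ => ?_
    rw [prod_const, card_filter_mem_powersetCard]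
  have hu : P ^ c ≤ (e / N) ^ N := by
    have h := prod_le_mean_pow_card (powersetCard k (univ : Finset (Fin n)))
      (fun S => ∏ i ∈ S, y i) (fun S _ => prod_nonneg fun i _ => (hy i).le)
    rw [hprod, card_powersetCard, card_fin] at h
    exact (pow_le_pow_left₀ hP.le hPy c).trans h
  have he0 : 0 ≤ e := sum_nonneg fun S _ => prod_nonneg fun i _ => (hy i).le
  have hexp : (n - k) * N = n * (N - c) := by
    rw [Nat.sub_mul, Nat.mul_sub, ← hcount, mul_comm k N]
  -- Split `P ^ N` as `P ^ c * P ^ (N - c)`: the first factor is controlled by the mean of the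
  -- `k`-fold products, the second by the mean `s / n`. The identity `N k = n c` makes the exponents
  -- match.
  have hpow : P ^ N ≤ (e / N * (s / n) ^ (n - k)) ^ N := by
    rw [mul_pow, ← pow_mul, hexp, pow_mul]
    calc P ^ N = P ^ c * P ^ (N - c) := by rw [← pow_add]; congr 1; omega
      _ ≤ _ := mul_le_mul hu (pow_le_pow_left₀ hP.le hPs _) (by positivity) (by positivity)
  have hfin : P ≤ e / N * (s / n) ^ (n - k) :=
    le_of_pow_le_pow_left₀ hNpos.ne' (by positivity) hpow
  calc N * (n : ℝ) ^ (n - k) * P ≤ N * (n : ℝ) ^ (n - k) * (e / N * (s / n) ^ (n - k)) :=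
        mul_le_mul_of_nonneg_left hfin (by positivity)
    _ = e * s ^ (n - k) := by rw [div_pow]; field_simp

/-- For a doubly stochastic matrix, the product of the coordinates does not decrease. -/
theorem prod_le_prod_sum_of_mem_doublyStochastic {n : ℕ} {A : Matrix (Fin n) (Fin n) ℝ}
    (hA : A ∈ doublyStochastic ℝ (Fin n)) {x : Fin n → ℝ} (hx : ∀ j, 0 < x j) :
    ∏ j, x j ≤ ∏ i, ∑ j, A i j * x j := by
  calc ∏ j, x j = ∏ j, ∏ i, x j ^ A i j := by
        refine Finset.prod_congr rfl fun j _ => ?_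
        rw [← Real.rpow_sum_of_pos (hx j), sum_col_of_mem_doublyStochastic hA, Real.rpow_one]
    _ = ∏ i, ∏ j, x j ^ A i j := Finset.prod_comm
    _ ≤ _ := by
        refine Finset.prod_le_prod
          (fun i _ => Finset.prod_nonneg fun j _ => Real.rpow_nonneg (hx j).le _) fun i _ => ?_
        exact Real.geom_mean_le_arith_mean_weighted _ _ _
          (fun j _ => nonneg_of_mem_doublyStochastic hA)
          (sum_row_of_mem_doublyStochastic hA i) (fun j _ => (hx j).le)

/-! ### The polynomial whose multilinear coefficient collects the subpermanents. -/

namespace MvPolynomial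

/-- The coefficient of the product of all variables in a product of linear forms is a permanent. -/
theorem coeff_one_prod_sum_C_mul_X {R : Type*} [CommSemiring R] {n : ℕ}
    (b : Fin n → Fin n → R) :
    coeff (Finsupp.equivFunOnFinite.symm fun _ => 1) (∏ i, ∑ j, C (b i j) * X j)
      = ∑ σ : Equiv.Perm (Fin n), ∏ i, b i (σ i) := by
  classical
  rw [Fintype.prod_sum, coeff_sum]
  symm
  have hterm : ∀ p : Fin n → Fin n, ∏ i, (C (b i (p i)) * X (p i) : MvPolynomial (Fin n) R)
      = monomial (∑ i, Finsupp.single (p i) 1) (∏ i, b i (p i)) := by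
    intro p
    rw [monomial_sum_index, Finset.prod_mul_distrib, map_prod]
    rfl
  have hval : ∀ (p : Fin n → Fin n) (j : Fin n), (∑ i, Finsupp.single (p i) 1 : Fin n →₀ ℕ) j
      = (Finset.univ.filter fun i => p i = j).card := by
    intro p j
    rw [Finsupp.finsetSum_apply, Finset.card_filter]
    simp [Finsupp.single_apply]
  refine Finset.sum_of_injOn (fun σ : Equiv.Perm (Fin n) => (σ : Fin n → Fin n))
    DFunLike.coe_injective.injOn (fun _ _ => Finset.mem_coe.2 (Finset.mem_univ _)) ?_ ?_
  · intro p _ hp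
    rw [hterm, coeff_monomial, if_neg]
    intro h
    have hsurj : Function.Surjective p := by
      intro j
      have hj := DFunLike.congr_fun h j
      rw [hval] at hj
      have hpos : 0 < (Finset.univ.filter fun i => p i = j).card := by rw [hj]; simp
      obtain ⟨i, hi⟩ := Finset.card_pos.1 hpos
      exact ⟨i, (Finset.mem_filter.1 hi).2⟩
    exact hp ⟨Equiv.ofBijective p (Finite.surjective_iff_bijective.1 hsurj), by simp, rfl⟩
  · intro σ _
    rw [hterm, coeff_monomial, if_pos]
    ext j
    rw [hval]
    have : (Finset.univ.filter fun i => σ i = j) = {σ.symm j} := by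
      ext i
      simp [Equiv.eq_symm_apply]
    rw [this]
    simp

/-- The sum of the `k`-fold products of the linear forms given by the rows of `A`, multiplied by
the power of the sum of the variables that makes it homogeneous of degree `n`. -/
noncomputable def rowEsymm {n : ℕ} (A : Matrix (Fin n) (Fin n) ℝ) (k : ℕ) :
    MvPolynomial (Fin n) ℂ :=
  (∑ S ∈ Finset.powersetCard k Finset.univ, ∏ i ∈ S, ∑ j, C (A i j : ℂ) * X j)
    * (∑ j, X j) ^ (n - k)

variable {n k : ℕ} {A : Matrix (Fin n) (Fin n) ℝ}

theorem eval_rowEsymm (A : Matrix (Fin n) (Fin n) ℝ) (k : ℕ) (z : Fin n → ℂ) :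
    eval z (rowEsymm A k) = (∑ S ∈ Finset.powersetCard k Finset.univ, ∏ i ∈ S, ∑ j, A i j * z j)
      * (∑ j, z j) ^ (n - k) := by
  simp [rowEsymm]

theorem isHomogeneous_rowEsymm (A : Matrix (Fin n) (Fin n) ℝ) (hk : k ≤ n) :
    (rowEsymm A k).IsHomogeneous n := by
  have h1 : (∑ S ∈ Finset.powersetCard k (Finset.univ : Finset (Fin n)),
      ∏ i ∈ S, ∑ j, (C (A i j : ℂ) * X j : MvPolynomial (Fin n) ℂ)).IsHomogeneous k := by
    refine IsHomogeneous.sum _ _ _ fun S hS => ?_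
    have h := IsHomogeneous.prod S (fun i => ∑ j, (C (A i j : ℂ) * X j : MvPolynomial (Fin n) ℂ))
      (fun _ => 1) (fun i _ => IsHomogeneous.sum _ _ _ fun j _ => isHomogeneous_C_mul_X _ _)
    simpa [(Finset.mem_powersetCard.1 hS).2] using h
  have h2 : (∑ j, X j : MvPolynomial (Fin n) ℂ).IsHomogeneous 1 :=
    IsHomogeneous.sum _ _ _ fun j _ => isHomogeneous_X _ _
  have h := h1.mul (h2.pow (n - k))
  rw [one_mul, Nat.add_sub_cancel' hk] at h
  exact h

theorem isStronglyStable_rowEsymm (hA : ∀ i j, 0 < A i j) (hk : k ≤ n) :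
    IsStronglyStable (rowEsymm A k) := by
  intro z hz hz'
  rw [eval_rowEsymm]
  have hpos : ∀ a : Fin n → ℝ, (∀ j, 0 < a j) → 0 < (∑ j, (a j : ℂ) * z j).re := by
    intro a ha
    obtain ⟨j₀, hj₀⟩ := hz'
    simp only [Complex.re_sum, Complex.re_ofReal_mul]
    exact Finset.sum_pos' (fun j _ => mul_nonneg (ha j).le (hz j))
      ⟨j₀, Finset.mem_univ _, mul_pos (ha j₀) hj₀⟩
  refine mul_ne_zero ?_ (pow_ne_zero _ fun h => ?_)
  -- The elementary symmetric sum of the row forms `Lᵢ` is a coefficient of `∏ (X + Lᵢ)`, whose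
  -- roots `-Lᵢ` have negative real part.
  · have hc := Finset.prod_X_add_C_coeff (Finset.univ : Finset (Fin n))
      (fun i => ∑ j, (A i j : ℂ) * z j) (k := n - k) (by simp)
    rw [Finset.card_fin, Nat.sub_sub_self hk] at hc
    rw [← hc]
    have hmonic : (∏ i : Fin n, (Polynomial.X + Polynomial.C (∑ j, (A i j : ℂ) * z j))).Monic :=
      Polynomial.monic_prod_of_monic _ _ fun i _ => Polynomial.monic_X_add_C _
    refine Polynomial.coeff_ne_zero_of_forall_root_re_neg hmonic.ne_zero (fun w hw => ?_) ?_
    · rw [Polynomial.eval_prod, Finset.prod_eq_zero_iff] at hw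
      obtain ⟨i, -, hi⟩ := hw
      rw [Polynomial.eval_add, Polynomial.eval_X, Polynomial.eval_C] at hi
      have := hpos (A i) (hA i)
      rw [eq_neg_of_add_eq_zero_left hi, Complex.neg_re]
      linarith
    · rw [Polynomial.natDegree_prod_of_monic _ _ fun i _ => Polynomial.monic_X_add_C _]
      simp only [Polynomial.natDegree_X_add_C]
      simp
  · have := hpos (fun _ => 1) (fun _ => one_pos)
    simp [h] at this

theorem coeff_one_rowEsymm (A : Matrix (Fin n) (Fin n) ℝ) (k : ℕ) :
    coeff (Finsupp.equivFunOnFinite.symm fun _ => 1) (rowEsymm A k) =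
      ((∑ S ∈ Finset.powersetCard k Finset.univ, ∑ σ : Equiv.Perm (Fin n),
        ∏ i ∈ S, A i (σ i) : ℝ) : ℂ) := by
  classical
  rw [rowEsymm, Finset.sum_mul, coeff_sum]
  push_cast
  refine Finset.sum_congr rfl fun S hS => ?_
  -- The `n - k` extra factors play the role of all-ones rows outside `S`, so the coefficient is a
  -- permanent.
  have hprod : (∏ i ∈ S, ∑ j, C (A i j : ℂ) * X j) * (∑ j, X j : MvPolynomial (Fin n) ℂ) ^ (n - k)
      = ∏ i, ∑ j, C (if i ∈ S then (A i j : ℂ) else 1) * X j := by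
    rw [← Finset.prod_mul_prod_compl S]
    congr 1
    · refine Finset.prod_congr rfl fun i hi => ?_
      simp [hi]
    · have hcard : Sᶜ.card = n - k := by
        rw [Finset.card_compl, Fintype.card_fin, (Finset.mem_powersetCard.1 hS).2]
      rw [← hcard, ← Finset.prod_const]
      refine Finset.prod_congr rfl fun i hi => ?_
      rw [Finset.mem_compl] at hi
      simp [hi]
  rw [hprod, coeff_one_prod_sum_C_mul_X]
  refine Finset.sum_congr rfl fun σ _ => ?_
  rw [Finset.prod_ite_mem, Finset.univ_inter]

theorem capacity_rowEsymm_ge (hA : A ∈ doublyStochastic ℝ (Fin n)) (hpos : ∀ i j, 0 < A i j)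
    (hn : n ≠ 0) (hk : k ≤ n) {x : Fin n → ℝ} (hx : ∀ j, 0 < x j) :
    n.choose k * (n : ℝ) ^ (n - k) * ∏ j, x j ≤ ‖eval (fun j => (x j : ℂ)) (rowEsymm A k)‖ := by
  have : NeZero n := ⟨hn⟩
  have hy : ∀ i, 0 < ∑ j, A i j * x j := fun i =>
    Finset.sum_pos (fun j _ => mul_pos (hpos i j) (hx j)) Finset.univ_nonempty
  have hs : 0 ≤ ∑ j, x j := Finset.sum_nonneg fun j _ => (hx j).le
  have hmean := prod_le_mean_pow_card Finset.univ x (fun j _ => (hx j).le)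
  rw [Finset.card_fin] at hmean
  have h := choose_mul_pow_mul_le_esymm_mul_pow hn hk hy (Finset.prod_pos fun j _ => hx j) hs
    (prod_le_prod_sum_of_mem_doublyStochastic hA hx) hmean
  refine h.trans ?_
  have he : eval (fun j => (x j : ℂ)) (rowEsymm A k) =
      (((∑ S ∈ Finset.powersetCard k Finset.univ, ∏ i ∈ S, ∑ j, A i j * x j)
        * (∑ j, x j) ^ (n - k) : ℝ) : ℂ) := by
    rw [eval_rowEsymm]
    push_cast
    rfl
  rw [he, Complex.norm_real]
  exact le_abs_self _

end MvPolynomial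

/-! ### The permanent inequality. -/

theorem le_sum_sum_prod_of_pos {n k : ℕ} {A : Matrix (Fin n) (Fin n) ℝ}
    (hA : A ∈ doublyStochastic ℝ (Fin n)) (hpos : ∀ i j, 0 < A i j) (hn : n ≠ 0) (hk : k ≤ n) :
    n.choose k * (n : ℝ) ^ (n - k) * (n ! / (n : ℝ) ^ n) ≤
      ∑ S ∈ Finset.powersetCard k Finset.univ, ∑ σ : Equiv.Perm (Fin n), ∏ i ∈ S, A i (σ i) := by
  have h := (MvPolynomial.isStronglyStable_rowEsymm hpos hk).mul_factorial_div_le_norm_coeff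
    (MvPolynomial.isHomogeneous_rowEsymm A hk)
    fun x hx => MvPolynomial.capacity_rowEsymm_ge hA hpos hn hk hx
  rw [MvPolynomial.coeff_one_rowEsymm, Complex.norm_real, Real.norm_of_nonneg] at h
  · exact h
  · exact Finset.sum_nonneg fun S _ => Finset.sum_nonneg fun σ _ =>
      Finset.prod_nonneg fun i _ => (hpos i _).le

/-- The Tverberg permanent inequality for doubly stochastic matrices. The right hand side is
`(n - k)!` times the sum of the permanents of the `k × k` submatrices. -/
theorem le_sum_sum_prod_of_mem_doublyStochastic {n k : ℕ} {A : Matrix (Fin n) (Fin n) ℝ}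
    (hA : A ∈ doublyStochastic ℝ (Fin n)) (hn : n ≠ 0) (hk : k ≤ n) :
    n.choose k * (n : ℝ) ^ (n - k) * (n ! / (n : ℝ) ^ n) ≤
      ∑ S ∈ Finset.powersetCard k Finset.univ, ∑ σ : Equiv.Perm (Fin n), ∏ i ∈ S, A i (σ i) := by
  have hn' : (n : ℝ) ≠ 0 := by exact_mod_cast hn
  -- Mixing with the constant matrix `1/n` keeps `A` doubly stochastic and makes it positive for `0
  -- < ε < 1`; then `ε → 0⁺`.
  let F : ℝ → Matrix (Fin n) (Fin n) ℝ := fun ε i j => (1 - ε) * A i j + ε * (n : ℝ)⁻¹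
  have hcont : Continuous fun ε => ∑ S ∈ Finset.powersetCard k Finset.univ,
      ∑ σ : Equiv.Perm (Fin n), ∏ i ∈ S, F ε i (σ i) := by
    refine continuous_finsetSum _ fun S _ => continuous_finsetSum _ fun σ _ =>
      continuous_finsetProd _ fun i _ => ?_
    fun_prop
  have hlim := (hcont.tendsto 0).mono_left (nhdsWithin_le_nhds (s := Set.Ioi 0))
  have hF0 : F 0 = A := by
    ext i j
    simp [F]
  rw [hF0] at hlim
  refine ge_of_tendsto hlim ?_
  filter_upwards [Ioo_mem_nhdsGT (zero_lt_one' ℝ)] with ε hε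
  have hpos : ∀ i j, 0 < F ε i j := fun i j => by
    have h1 : 0 ≤ (1 - ε) * A i j :=
      mul_nonneg (by linarith [hε.2]) (nonneg_of_mem_doublyStochastic hA)
    have h2 : 0 < ε * (n : ℝ)⁻¹ := mul_pos hε.1 (by positivity)
    exact add_pos_of_nonneg_of_pos h1 h2
  refine le_sum_sum_prod_of_pos ?_ hpos hn hk
  refine mem_doublyStochastic_iff_sum.2 ⟨fun i j => (hpos i j).le, fun i => ?_, fun j => ?_⟩
  · simp only [F]
    rw [Finset.sum_add_distrib, ← Finset.mul_sum, sum_row_of_mem_doublyStochastic hA]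
    simp
    field_simp
    ring
  · simp only [F]
    rw [Finset.sum_add_distrib, ← Finset.mul_sum, sum_col_of_mem_doublyStochastic hA]
    simp
    field_simp
    ring

/-! ### Counting matchings by partial permutations. -/

theorem card_perm_agreeing_on_le {n : ℕ} (S : Finset (Fin n)) (τ : Equiv.Perm (Fin n)) :
    (Finset.univ.filter fun σ : Equiv.Perm (Fin n) => ∀ i ∈ S, σ i = τ i).card
      ≤ (n - S.card)! := by
  classical
  have hcard : Fintype.card (Equiv.Perm {i // i ∉ S}) = (n - S.card)! := by
    rw [Fintype.card_perm, Fintype.card_subtype_compl, Fintype.card_fin, Fintype.card_coe]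
  rw [← hcard, Fintype.card_congr (Equiv.Perm.subtypeEquivSubtypePerm fun i => i ∉ S),
    Fintype.card_subtype]
  -- `τ⁻¹ * σ` fixes `S` pointwise, so it is a permutation of the complement.
  refine Finset.card_le_card_of_injOn (fun σ => τ⁻¹ * σ) (fun σ hσ => ?_)
    (mul_right_injective τ⁻¹).injOn
  simp only [Finset.coe_filter, Finset.mem_univ, true_and, Set.mem_ofPred_eq, not_not] at hσ ⊢
  intro i hi
  simp [Equiv.Perm.mul_apply, hσ i hi]

section Matchings

variable {V : Type*} {n : ℕ} {a b : Fin n → V}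

theorem sym2_mk_eq_mk_iff_of_injective (ha : Function.Injective a) (hb : Function.Injective b)
    (hab : ∀ i j, a i ≠ b j) {i i' j j' : Fin n} :
    s(a i, b j) = s(a i', b j') ↔ i = i' ∧ j = j' := by
  rw [Sym2.eq_iff, ha.eq_iff, hb.eq_iff]
  simp [hab]

open scoped Classical in
/-- Every matching of size `k` arises from at most `(n - k)!` pairs consisting of a set of `k` rows
and a permutation. -/
theorem card_partial_perm_le_ncard_matchingsOfSize_mul [Fintype V] (G : SimpleGraph V)
    (ha : Function.Injective a) (hb : Function.Injective b) (hab : ∀ i j, a i ≠ b j) (k : ℕ) :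
    ((Finset.powersetCard k Finset.univ ×ˢ Finset.univ).filter
      fun p : Finset (Fin n) × Equiv.Perm (Fin n) => ∀ i ∈ p.1, G.Adj (a i) (b (p.2 i))).card
      ≤ (matchingsOfSize G k).ncard * (n - k)! := by
  set T := (Finset.powersetCard k Finset.univ ×ˢ Finset.univ).filter
    fun p : Finset (Fin n) × Equiv.Perm (Fin n) => ∀ i ∈ p.1, G.Adj (a i) (b (p.2 i)) with hT
  let Φ : Finset (Fin n) × Equiv.Perm (Fin n) → Finset (Sym2 V) :=
    fun p => p.1.image fun i => s(a i, b (p.2 i))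
  have hmem : ∀ p, p ∈ T ↔ p.1.card = k ∧ ∀ i ∈ p.1, G.Adj (a i) (b (p.2 i)) := by
    intro p
    simp [hT, Finset.mem_powersetCard]
  have hfiber : ∀ M ∈ T.image Φ, (T.filter fun p => Φ p = M).card ≤ (n - k)! := by
    intro M hM
    obtain ⟨⟨S, τ⟩, hp, rfl⟩ := Finset.mem_image.1 hM
    have hS : S.card = k := ((hmem _).1 hp).1
    rw [← hS]
    refine le_trans ?_ (card_perm_agreeing_on_le S τ)
    refine (Finset.card_le_card (t := {S} ×ˢ (Finset.univ.filter
      fun σ : Equiv.Perm (Fin n) => ∀ i ∈ S, σ i = τ i)) ?_).trans (by simp)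
    rintro ⟨S', σ⟩ hp'
    obtain ⟨hp'T, heq⟩ := Finset.mem_filter.1 hp'
    have hsub : ∀ i ∈ S', i ∈ S ∧ σ i = τ i := by
      intro i hi
      have : s(a i, b (σ i)) ∈ Φ (S, τ) := heq ▸ Finset.mem_image_of_mem _ hi
      obtain ⟨i', hi', h⟩ := Finset.mem_image.1 this
      obtain ⟨rfl, h2⟩ := (sym2_mk_eq_mk_iff_of_injective ha hb hab).1 h
      exact ⟨hi', h2.symm⟩
    have hSS : S' = S := Finset.eq_of_subset_of_card_le (fun i hi => (hsub i hi).1)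
      (by rw [hS, ((hmem _).1 hp'T).1])
    subst hSS
    simpa using fun i hi => (hsub i hi).2
  have himage : (T.image Φ).card ≤ (matchingsOfSize G k).ncard := by
    rw [← Set.ncard_coe_finset]
    refine Set.ncard_le_ncard ?_ (Set.toFinite _)
    intro M hM
    obtain ⟨⟨S, σ⟩, hp, rfl⟩ := Finset.mem_image.1 (Finset.mem_coe.1 hM)
    obtain ⟨hS, hadj⟩ := (hmem _).1 hp
    refine ⟨fun e he => ?_, fun e he f hf hef v hve hvf => ?_, ?_⟩
    · obtain ⟨i, hi, rfl⟩ := Finset.mem_image.1 he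
      exact hadj i hi
    · obtain ⟨i, hi, rfl⟩ := Finset.mem_image.1 he
      obtain ⟨j, hj, rfl⟩ := Finset.mem_image.1 hf
      apply hef
      simp only [Sym2.mem_iff] at hve hvf
      have hij : i = j := by
        rcases hve with rfl | rfl <;> rcases hvf with h | h
        · exact ha h
        · exact absurd h (hab _ _)
        · exact absurd h.symm (hab _ _)
        · exact σ.injective (hb h)
      rw [hij]
    · rw [Finset.card_image_of_injective _ fun i j h =>
        ((sym2_mk_eq_mk_iff_of_injective ha hb hab).1 h).1]
      exact hS
  calc T.card ≤ (n - k)! * (T.image Φ).card := Finset.card_le_mul_card_image _ _ hfiber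
    _ ≤ (matchingsOfSize G k).ncard * (n - k)! := by
        rw [mul_comm]
        exact Nat.mul_le_mul_right _ himage

open scoped Classical in
/-- The biadjacency matrix of a regular bipartite graph, scaled to have unit row sums. -/
noncomputable def scaledBiadjacency (G : SimpleGraph V) (a b : Fin n → V) (r : ℕ) :
    Matrix (Fin n) (Fin n) ℝ :=
  fun i j => if G.Adj (a i) (b j) then (r : ℝ)⁻¹ else 0

open scoped Classical in
theorem SimpleGraph.card_filter_adj_eq_degree {V ι : Type*} [Fintype ι] {G : SimpleGraph V}
    {b : ι → V} (hb : Function.Injective b) (v : V) [Fintype (G.neighborSet v)]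
    (h : ∀ w, G.Adj v w → w ∈ Set.range b) :
    (Finset.univ.filter fun j => G.Adj v (b j)).card = G.degree v := by
  rw [← Finset.card_image_of_injective _ hb, ← G.card_neighborFinset_eq_degree]
  congr 1
  ext w
  simp only [Finset.mem_image, Finset.mem_filter, Finset.mem_univ, true_and,
    SimpleGraph.mem_neighborFinset]
  constructor
  · rintro ⟨j, hj, rfl⟩
    exact hj
  · intro hw
    obtain ⟨j, rfl⟩ := h w hw
    exact ⟨j, hw, rfl⟩

theorem scaledBiadjacency_mem_doublyStochastic {G : SimpleGraph V} [G.LocallyFinite] {r : ℕ}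
    (ha : Function.Injective a) (hb : Function.Injective b)
    (hbip : G.IsBipartiteWith (Set.range a) (Set.range b)) (hreg : G.IsRegularOfDegree r)
    (hr : r ≠ 0) : scaledBiadjacency G a b r ∈ doublyStochastic ℝ (Fin n) := by
  classical
  have hr' : (r : ℝ) ≠ 0 := by exact_mod_cast hr
  refine mem_doublyStochastic_iff_sum.2 ⟨fun i j => ?_, fun i => ?_, fun j => ?_⟩
  · unfold scaledBiadjacency
    split_ifs <;> positivity
  · simp only [scaledBiadjacency]
    rw [← Finset.sum_filter, Finset.sum_const, SimpleGraph.card_filter_adj_eq_degree hb (a i)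
      fun w hw => hbip.mem_of_mem_adj ⟨i, rfl⟩ hw, hreg.degree_eq, nsmul_eq_mul,
      mul_inv_cancel₀ hr']
  · simp only [scaledBiadjacency, G.adj_comm _ (b j)]
    rw [← Finset.sum_filter, Finset.sum_const, SimpleGraph.card_filter_adj_eq_degree ha (b j)
      fun w hw => hbip.mem_of_mem_adj' ⟨j, rfl⟩ hw.symm, hreg.degree_eq, nsmul_eq_mul,
      mul_inv_cancel₀ hr']

open scoped Classical in
theorem sum_sum_prod_scaledBiadjacency (G : SimpleGraph V) (a b : Fin n → V) (r k : ℕ) :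
    ∑ S ∈ Finset.powersetCard k Finset.univ, ∑ σ : Equiv.Perm (Fin n),
      ∏ i ∈ S, scaledBiadjacency G a b r i (σ i) =
    ((Finset.powersetCard k Finset.univ ×ˢ Finset.univ).filter
      fun p : Finset (Fin n) × Equiv.Perm (Fin n) =>
        ∀ i ∈ p.1, G.Adj (a i) (b (p.2 i))).card * ((r : ℝ)⁻¹) ^ k := by
  rw [← Finset.sum_product', ← nsmul_eq_mul, ← Finset.sum_const, Finset.sum_filter]
  refine Finset.sum_congr rfl fun p hp => ?_
  have hcard : p.1.card = k := (Finset.mem_powersetCard.1 (Finset.mem_product.1 hp).1).2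
  split_ifs with h
  · rw [← hcard, ← Finset.prod_const]
    exact Finset.prod_congr rfl fun i hi => if_pos (h i hi)
  · push Not at h
    obtain ⟨i, hi, hadj⟩ := h
    exact Finset.prod_eq_zero hi (if_neg hadj)

end Matchings

theorem theorem5p1 {V : Type*} [Fintype V] (G : SimpleGraph V) [G.LocallyFinite]
    (X Y : Set V) (hbip : G.IsBipartiteWith X Y) (hcover : X ∪ Y = Set.univ)
    (n r s : ℕ) (hX : X.ncard = n) (hY : Y.ncard = n) (hreg : G.IsRegularOfDegree r) :
    (n.choose s : ℝ) ^ 2 * (s ! : ℝ) * ((r : ℝ) / (n : ℝ)) ^ s ≤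
      ((matchingsOfSize G s).ncard : ℝ) := by
  classical
  -- For `s = 0` the empty matching suffices, whatever `n` and `r` are. For `s > 0` the left side
  -- vanishes when `n < s` or `r = 0`, which leaves `n` and `r` nonzero.
  rcases eq_or_ne s 0 with rfl | hs0
  · have hmem : (∅ : Finset (Sym2 V)) ∈ matchingsOfSize G 0 := by simp [matchingsOfSize]
    have hpos : 0 < (matchingsOfSize G 0).ncard :=
      (Set.ncard_pos (Set.toFinite _)).2 ⟨∅, hmem⟩
    simpa using Nat.one_le_iff_ne_zero.2 hpos.ne'
  rcases lt_or_ge n s with hns | hsn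
  · simp [Nat.choose_eq_zero_of_lt hns]
  have hn : n ≠ 0 := by omega
  rcases eq_or_ne r 0 with rfl | hr
  · simp [hs0]
  have eX : X ≃ Fin n := Finite.equivFinOfCardEq hX
  have eY : Y ≃ Fin n := Finite.equivFinOfCardEq hY
  let a : Fin n → V := fun i => eX.symm i
  let b : Fin n → V := fun i => eY.symm i
  have ha : Function.Injective a := Subtype.val_injective.comp eX.symm.injective
  have hb : Function.Injective b := Subtype.val_injective.comp eY.symm.injective
  have hrange : ∀ (Z : Set V) (e : Z ≃ Fin n), Set.range (fun i => (e.symm i : V)) = Z := by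
    intro Z e
    rw [← Function.comp_def Subtype.val e.symm, e.symm.surjective.range_comp, Subtype.range_coe]
  have hbip' : G.IsBipartiteWith (Set.range a) (Set.range b) := by
    rwa [hrange X eX, hrange Y eY]
  have hab : ∀ i j, a i ≠ b j := fun i j =>
    hbip'.disjoint.ne_of_mem (Set.mem_range_self i) (Set.mem_range_self j)
  have h1 := le_sum_sum_prod_of_mem_doublyStochastic
    (scaledBiadjacency_mem_doublyStochastic ha hb hbip' hreg hr) hn hsn
  rw [sum_sum_prod_scaledBiadjacency] at h1
  have h2 := card_partial_perm_le_ncard_matchingsOfSize_mul G ha hb hab s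
  set N := ((Finset.powersetCard s Finset.univ ×ˢ Finset.univ).filter
    fun p : Finset (Fin n) × Equiv.Perm (Fin n) => ∀ i ∈ p.1, G.Adj (a i) (b (p.2 i))).card
  have h2' : (N : ℝ) ≤ (matchingsOfSize G s).ncard * (n - s)! := by exact_mod_cast h2
  have hfact : (n.choose s : ℝ) * s ! * (n - s)! = n ! := by
    exact_mod_cast Nat.choose_mul_factorial_mul_factorial hsn
  have hr' : (0 : ℝ) < r := by positivity
  have hn' : (0 : ℝ) < n := by positivity
  refine le_of_mul_le_mul_right (le_trans ?_ h2') (show (0 : ℝ) < (n - s)! by positivity)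
  have hpow : (n : ℝ) ^ n = (n : ℝ) ^ (n - s) * (n : ℝ) ^ s := by
    rw [← pow_add, Nat.sub_add_cancel hsn]
  calc (n.choose s : ℝ) ^ 2 * s ! * ((r : ℝ) / n) ^ s * (n - s)!
      = n.choose s * (n.choose s * s ! * (n - s)!) * ((r : ℝ) / n) ^ s := by ring
    _ = n.choose s * (n : ℝ) ^ (n - s) * (n ! / (n : ℝ) ^ n) * (r : ℝ) ^ s := by
        rw [hfact, hpow, div_pow]
        field_simp
    _ ≤ N * ((r : ℝ)⁻¹) ^ s * (r : ℝ) ^ s := mul_le_mul_of_nonneg_right h1 (by positivity)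
    _ = N := by rw [mul_assoc, ← mul_pow, inv_mul_cancel₀ hr'.ne', one_pow, mul_one]
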